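/- Let $d\ge 1$ be an integer. For a noncrossing partition $\pi$ of $[n]=\{1,\dots,n\}$ let $\pi'$ be its Kreweras dual: place $1,1',2,2',\dots,n,n'$ in this order on a circle; $\pi'$ is the partition of $\{1',\dots,n'\}$ in which $i'$ and $j'$ are in the same block if and only if no convex hull of a block of $\pi$ separates them. Let $\mathrm{NC}^d_n$ be the set of noncrossing partitions $\pi$ of $[n]$ such that all blocks of $\pi$ and of $\pi'$ have cardinality congruent to $1$ modulo $d$. Write $|\pi|$ for the number of blocks of $\pi$. Let $R$ be a commutative ring, let $s,t\in R$ (for instance indeterminates), and let $(a(k))_{k\ge 0}$ and $(a^*(k))_{k\ge 0}$ be sequences in $R$ with $a(0)=a^*(0)=1$. For $\pi\in\mathrm{NC}^d_{dk+1}$ put $$\mathrm{wt}(\pi)=\prod_{B\in\pi}a\!\left(\tfrac{|B|-1}{d}\right)\cdot\prod_{C'\in\pi'}a^*\!\left(\tfrac{|C'|-1}{d}\right)\cdot s^{(|\pi|-1)/d}\cdot t^{(|\pi'|-1)/d},$$ where the exponents of $s$ and $t$ are the corank and the rank of $\pi$ in $\mathrm{NC}^d_{dk+1}$, ordered by refinement.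 Define the formal power series $A(x)=\sum_{k\ge0}a(k)x^k$, $A^*(x)=\sum_{k\ge0}a^*(k)x^k$ and $$B(x)=\sum_{k\ge0}\Bigl(\sum_{\pi\in\mathrm{NC}^d_{dk+1}}\mathrm{wt}(\pi)\Bigr)x^k,\quad C(x)=\sum_{k\ge0}\Bigl(\sum_{\substack{\pi\in\mathrm{NC}^d_{dk+1}\\ \{1\}\in\pi}}\mathrm{wt}(\pi)\Bigr)x^k,\quad C^*(x)=\sum_{k\ge0}\Bigl(\sum_{\substack{\pi\in\mathrm{NC}^d_{dk+1}\\ \{1'\}\in\pi'}}\mathrm{wt}(\pi)\Bigr)x^k .$$ Then, in $R[[x]]$, $$C(x)=A^*\bigl(x\,s\,C^*(x)^d\bigr),\qquad C^*(x)=A\bigl(x\,t\,C(x)^d\bigr),\qquad B(x)=C(x)\,C^*(x).$$ Furthermore, the first two equations determine $C$ and $C^*$ uniquely: if $F,G\in R[[x]]$ satisfy $F(x)=A^*(x\,s\,G(x)^d)$ and $G(x)=A(x\,t\,F(x)^d)$, then $F=C$ and $G=C^*$. -/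

import Mathlib

namespace IndivisibleNC

open Finset

/-- A partition of `Fin n` (the element `i : Fin n` stands for `i + 1 ∈ [n]`) is noncrossing if
no two different blocks `B`, `C` have `i < j < k < l` with `i, k ∈ B` and `j, l ∈ C`. -/
def IsNoncrossing {n : ℕ} (π : Finpartition (univ : Finset (Fin n))) : Prop :=
  ∀ B ∈ π.parts, ∀ C ∈ π.parts, B ≠ C →
    ¬ ∃ i ∈ B, ∃ j ∈ C, ∃ k ∈ B, ∃ l ∈ C, i < j ∧ j < k ∧ k < l

instance {n : ℕ} (π : Finpartition (univ : Finset (Fin n))) : Decidable (IsNoncrossing π) := by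
  unfold IsNoncrossing; infer_instance

/-- In the cyclic order `1 < 1' < 2 < 2' < ⋯ < n < n' < 1` the chord joining `i'` and `j'` cuts
the vertices `1, …, n` into two arcs. This is the arc that does not contain `1`: the vertices
`x` with `min i j < x ≤ max i j`. The other arc is its complement. -/
def arc {n : ℕ} (i j : Fin n) : Finset (Fin n) := Ioc (min i j) (max i j)

theorem mem_arc {n : ℕ} (i j x : Fin n) : x ∈ arc i j ↔ ¬ (i < x ↔ j < x) := by
  simp only [arc, mem_Ioc, min_lt_iff, ← not_lt, max_lt_iff]
  tauto

/-- The primed vertices `i'` and `j'` are in the same region of the circle representation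
of `π`, i.e. no (convex hull of a) block of `π` separates them: each block lies entirely on one
side of the chord from `i'` to `j'`. -/
def SameRegion {n : ℕ} (π : Finpartition (univ : Finset (Fin n))) (i j : Fin n) : Prop :=
  ∀ B ∈ π.parts, B ⊆ arc i j ∨ Disjoint B (arc i j)

instance {n : ℕ} (π : Finpartition (univ : Finset (Fin n))) : DecidableRel (SameRegion π) :=
  fun i j => by unfold SameRegion; infer_instance

/-- Being in the same region, as an equivalence relation on the primed vertices. -/
def regionSetoid {n : ℕ} (π : Finpartition (univ : Finset (Fin n))) : Setoid (Fin n) where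
  r := SameRegion π
  iseqv :=
    { refl := fun i B _ => Or.inr (by simp [arc])
      symm := fun {i j} h B hB => by simpa [arc, min_comm, max_comm] using h B hB
      trans := fun {i j k} h h' B hB => by
        have h₁ := h B hB
        have h₂ := h' B hB
        simp only [Finset.subset_iff, Finset.disjoint_left, mem_arc] at h₁ h₂ ⊢
        rcases h₁ with h₁ | h₁ <;> rcases h₂ with h₂ | h₂
        · exact Or.inr fun x hx => by have := h₁ hx; have := h₂ hx; tauto
        · exact Or.inl fun x hx => by have := h₁ hx; have := h₂ hx; tauto
        · exact Or.inl fun x hx => by have := h₁ hx; have := h₂ hx; tauto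
        · exact Or.inr fun x hx => by have := h₁ hx; have := h₂ hx; tauto }

instance {n : ℕ} (π : Finpartition (univ : Finset (Fin n))) : DecidableRel (regionSetoid π) :=
  inferInstanceAs (DecidableRel (SameRegion π))

/-- The Kreweras dual `π'`: the partition of the primed vertices `1', …, n'` (where `i'` sits
between `i` and `i + 1`) into regions. The primed vertex `i'` is represented by `i` itself. -/
def dual {n : ℕ} (π : Finpartition (univ : Finset (Fin n))) :
    Finpartition (univ : Finset (Fin n)) :=
  Finpartition.ofSetoid (regionSetoid π)

/-- `NC d n`: the `d`-indivisible noncrossing partitions of `[n]`, i.e. the noncrossing partitions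
`π` such that all blocks of `π` and of `π'` have cardinality congruent to `1` modulo `d`. -/
def NC (d n : ℕ) : Finset (Finpartition (univ : Finset (Fin n))) :=
  {π | IsNoncrossing π ∧ (∀ B ∈ π.parts, #B ≡ 1 [MOD d]) ∧
    (∀ B ∈ (dual π).parts, #B ≡ 1 [MOD d])}

variable {R : Type*} [CommRing R]

/-- The weight of `π`. For `π ∈ NC d (d * k + 1)` all the divisions are exact; the exponents of
`s` and `t` are the corank and the rank of `π`. -/
def wt (d : ℕ) (a a' : ℕ → R) (s t : R) {n : ℕ}
    (π : Finpartition (univ : Finset (Fin n))) : R :=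
  (∏ B ∈ π.parts, a ((#B - 1) / d)) * (∏ B ∈ (dual π).parts, a' ((#B - 1) / d)) *
    s ^ ((#π.parts - 1) / d) * t ^ ((#(dual π).parts - 1) / d)

/-- `b(k)`: the sum of the weights over all of `NC d (d * k + 1)`. -/
def b (d : ℕ) (a a' : ℕ → R) (s t : R) (k : ℕ) : R :=
  ∑ π ∈ NC d (d * k + 1), wt d a a' s t π

/-- `c(k)`: the sum of the weights over the partitions having `{1}` as a block. -/
def c (d : ℕ) (a a' : ℕ → R) (s t : R) (k : ℕ) : R :=
  ∑ π ∈ NC d (d * k + 1) with {0} ∈ π.parts, wt d a a' s t π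

/-- `c*(k)`: the sum of the weights over the partitions having `{1'}` as a block of the dual. -/
def cStar (d : ℕ) (a a' : ℕ → R) (s t : R) (k : ℕ) : R :=
  ∑ π ∈ NC d (d * k + 1) with {0} ∈ (dual π).parts, wt d a a' s t π

end IndivisibleNC

/-!
Let `i` be the last element of the block of `0`. Since no block crosses this one, the rest splits
into a noncrossing partition of `{0, …, i - 1}` and one of `{i + 1, …, n - 1}`. Iterating this
encodes noncrossing partitions by binary trees, and the mirror image of a tree encodes the Kreweras
dual read backwards. The blocks become the maximal left paths of the tree and the dual blocks its
maximal right paths, so that weighted sums over partitions become sums over trees.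

Let the block of `0` have a weight sequence `φ` of its own, while the other blocks have weights `α`
and the dual blocks `β`. Removing the root replaces `φ` by its shift in the left subtree and, in the
mirrored right subtree, exchanges the roles of `α` and `β`. The generating function therefore
satisfies `D φ = φ 0 + x * D (shift φ) * H`, with `H` independent of `φ`, and the solution of this
recursion is the series `∑ φ k * x ^ k` with `x * H` substituted for `x`. Partitions with the
block `{0}` correspond to trees with empty left subtree, and partitions with the dual block `{0'}`
to trees whose left spine ends in a leaf; deleting that node in either case shows that the series
of the theorem are themselves of the form `D φ`, and splitting at the root gives the product.

Block weights vanishing off the sizes `≡ 1` modulo `d` reduce the `d`-indivisible case to the above,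
all series then being series in `x ^ d`. Uniqueness holds because the system determines the
coefficients one after the other.
-/

namespace IndivisibleNC

open Finset BinaryTree
open scoped BinaryTree

section FiberPartition

variable {α β : Type*} [Fintype α] [DecidableEq α] [DecidableEq β]

instance decidableRelKer (f : α → β) : DecidableRel (Setoid.ker f) :=
  fun x y => inferInstanceAs (Decidable (f x = f y))

/-- The partition of a finite type into the nonempty fibers of `f`. -/
def fiberPartition (f : α → β) : Finpartition (univ : Finset α) :=
  Finpartition.ofSetoid (Setoid.ker f)

theorem mem_part_fiberPartition {f : α → β} {x y : α} :
    y ∈ (fiberPartition f).part x ↔ f x = f y :=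
  Finpartition.mem_part_ofSetoid_iff_rel

theorem mem_parts_fiberPartition {f : α → β} {B : Finset α} :
    B ∈ (fiberPartition f).parts ↔ ∃ x, ({y | f x = f y} : Finset α) = B :=
  mem_image.trans <| by simp only [mem_univ, true_and]; rfl

theorem eq_fiberPartition {π : Finpartition (univ : Finset α)} {f : α → β}
    (h : ∀ x y, y ∈ π.part x ↔ f x = f y) : π = fiberPartition f := by
  have hpart (x : α) : ({y | f x = f y} : Finset α) = π.part x := by
    ext y
    simp [h]
  ext B
  simp only [mem_parts_fiberPartition, hpart]
  constructor
  · intro hB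
    obtain ⟨x, hx⟩ := π.nonempty_of_mem_parts hB
    exact ⟨x, π.part_eq_of_mem hB hx⟩
  · rintro ⟨x, rfl⟩
    exact π.part_mem.2 (mem_univ x)

theorem prod_parts_fiberPartition {M : Type*} [CommMonoid M] {w : ℕ → M} (hw : w 0 = 1)
    {f : α → β} {s : Finset β} (hf : ∀ x, f x ∈ s) :
    ∏ B ∈ (fiberPartition f).parts, w #B = ∏ v ∈ s, w #{x | f x = v} := by
  have hparts : (fiberPartition f).parts
      = (univ.image f).image fun v => ({x | f x = v} : Finset α) := by
    ext B
    simp [mem_parts_fiberPartition, eq_comm]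
  have hinj : Set.InjOn (fun v => ({x | f x = v} : Finset α)) (univ.image f : Finset β) := by
    intro v hv v' _ h
    obtain ⟨x, -, rfl⟩ := mem_image.1 hv
    simpa using Finset.ext_iff.1 h x
  rw [hparts, prod_image hinj]
  refine prod_subset (fun v hv => ?_) fun v _ hv => ?_
  · obtain ⟨x, -, rfl⟩ := mem_image.1 hv
    exact hf x
  · have hempty : ({x | f x = v} : Finset α) = ∅ :=
      filter_eq_empty_iff.2 fun x _ hx => hv (mem_image.2 ⟨x, mem_univ x, hx⟩)
    rw [hempty, card_empty, hw]

theorem singleton_mem_parts_fiberPartition {f : α → β} {x : α} :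
    {x} ∈ (fiberPartition f).parts ↔ #{y | f y = f x} = 1 := by
  rw [mem_parts_fiberPartition, card_eq_one]
  constructor
  · rintro ⟨z, hz⟩
    have hzx : f z = f x := by simpa using Finset.ext_iff.1 hz x
    exact ⟨x, by simpa only [hzx, eq_comm] using hz⟩
  · rintro ⟨z, hz⟩
    obtain rfl : x = z := by simpa using Finset.ext_iff.1 hz x
    exact ⟨x, by simpa only [eq_comm] using hz⟩

theorem sameRegion_fiberPartition {n : ℕ} {f : Fin n → β} {i j : Fin n} :
    SameRegion (fiberPartition f) i j ↔ ∀ x y, f x = f y → (x ∈ arc i j ↔ y ∈ arc i j) := by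
  simp only [SameRegion, mem_parts_fiberPartition, forall_exists_index,
    forall_apply_eq_imp_iff]
  refine forall_congr' fun x => ⟨?_, fun H => ?_⟩
  · rintro (h | h) y hxy
    · exact iff_of_true (h (by simp)) (h (by simpa using hxy))
    · exact iff_of_false (disjoint_left.1 h (by simp)) (disjoint_left.1 h (by simpa using hxy))
  · by_cases hx : x ∈ arc i j
    · exact .inl fun y hy => (H y (by simpa using hy)).1 hx
    · exact .inr (disjoint_left.2 fun y hy => mt (H y (by simpa using hy)).2 hx)

end FiberPartition

section BlockMin

/-- `f` sends each `x < n` to the least element of its block, for some noncrossing partition of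
`{0, …, n - 1}`. The second condition says both that `f` is idempotent (take `y = f x`) and that
no block having elements between `f x` and `x` extends below `f x`. -/
structure IsBlockMin (n : ℕ) (f : ℕ → ℕ) : Prop where
  le : ∀ x < n, f x ≤ x
  le_of_mem : ∀ x < n, ∀ y, f x ≤ y → y ≤ x → f x ≤ f y

namespace IsBlockMin

variable {n : ℕ} {f g : ℕ → ℕ}

theorem idem (hf : IsBlockMin n f) {x : ℕ} (hx : x < n) : f (f x) = f x :=
  (hf.le _ ((hf.le x hx).trans_lt hx)).antisymm (hf.le_of_mem x hx _ le_rfl (hf.le x hx))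

theorem isNoncrossing (hf : IsBlockMin n f) :
    IsNoncrossing (fiberPartition fun x : Fin n => f x) := by
  intro B hB B' hB' hne ⟨x, hx, y, hy, z, hz, w, hw, hxy, hyz, hzw⟩
  obtain ⟨p, rfl⟩ := mem_parts_fiberPartition.1 hB
  obtain ⟨q, rfl⟩ := mem_parts_fiberPartition.1 hB'
  simp only [mem_filter, mem_univ, true_and] at hx hy hz hw
  have hfx := hf.le x x.2
  have hfy := hf.le y y.2
  have hzy := hf.le_of_mem z z.2 y (by omega) (by omega)
  have hwz := hf.le_of_mem w w.2 z (by omega) (by omega)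
  have hpq : f p = f q := by omega
  exact hne (by simp only [hpq])

theorem eq_of_fiberPartition_eq (hf : IsBlockMin n f) (hg : IsBlockMin n g)
    (h : (fiberPartition fun x : Fin n => f x) = fiberPartition fun x : Fin n => g x) :
    ∀ x < n, f x = g x := by
  have hker {x y : ℕ} (hx : x < n) (hy : y < n) : f x = f y ↔ g x = g y := by
    rw [← mem_part_fiberPartition (f := fun x : Fin n => f x) (x := ⟨x, hx⟩) (y := ⟨y, hy⟩), h,
      mem_part_fiberPartition]
  intro x hx
  have hfx := hf.le x hx
  have hgx := hg.le x hx
  have hgf := (hker hx (by omega)).1 (hf.idem hx).symm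
  have hfg := (hker hx (by omega)).2 (hg.idem hx).symm
  have := hg.le (f x) (by omega)
  have := hf.le (g x) (by omega)
  omega

theorem sameRegion_iff (hf : IsBlockMin n f) {i j : Fin n} (hij : i ≤ j) :
    SameRegion (fiberPartition fun x : Fin n => f x) i j ↔
      ∀ x < n, (x ∈ Ioc (i : ℕ) j ↔ f x ∈ Ioc (i : ℕ) j) := by
  have harc (x : Fin n) : x ∈ arc i j ↔ (x : ℕ) ∈ Ioc (i : ℕ) j := by
    simp [arc, min_eq_left hij, max_eq_right hij]
  simp only [sameRegion_fiberPartition, harc]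
  refine ⟨fun H x hx => ?_, fun H x y hxy => ?_⟩
  · exact H ⟨x, hx⟩ ⟨f x, (hf.le x hx).trans_lt hx⟩ (hf.idem hx).symm
  · rw [H x x.2, H y y.2, hxy]

end IsBlockMin

theorem IsNoncrossing.exists_isBlockMin {n : ℕ} {π : Finpartition (univ : Finset (Fin n))}
    (hπ : IsNoncrossing π) :
    ∃ f : ℕ → ℕ, IsBlockMin n f ∧ (fiberPartition fun x : Fin n => f x) = π := by
  have hne (x : Fin n) : (π.part x).Nonempty := ⟨x, π.mem_part (mem_univ x)⟩
  let m (x : Fin n) : Fin n := (π.part x).min' (hne x)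
  have hm (x : Fin n) : m x ∈ π.part x := min'_mem _ _
  have hpart {x y : Fin n} : y ∈ π.part x ↔ π.part y = π.part x :=
    π.mem_part_iff_part_eq_part (mem_univ y) (mem_univ x)
  have hle {x y : Fin n} (h : y ∈ π.part x) : m x ≤ y := min'_le _ _ h
  have hcross (x y : Fin n) (hxy : m x ≤ y) (hyx : y ≤ x) : m x ≤ m y := by
    by_contra! hlt
    have hpxy : π.part y ≠ π.part x := fun h => hlt.not_ge (hle (h ▸ hm y))
    exact hπ _ (π.part_mem.2 (mem_univ y)) _ (π.part_mem.2 (mem_univ x)) hpxy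
      ⟨m y, hm y, m x, hm x, y, π.mem_part (mem_univ y), x, π.mem_part (mem_univ x), hlt,
        hxy.lt_of_ne fun h => hpxy (hpart.1 (h ▸ hm x)),
        hyx.lt_of_ne fun h => hpxy (by rw [h])⟩
  let f (x : ℕ) : ℕ := if hx : x < n then m ⟨x, hx⟩ else 0
  have hf (x : Fin n) : f x = m x := by simp [f]
  refine ⟨f, ⟨fun x hx => ?_, fun x hx y hxy hyx => ?_⟩, (eq_fiberPartition fun x y => ?_).symm⟩
  · lift x to Fin n using hx
    exact hf x ▸ hle (π.mem_part (mem_univ x))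
  · lift x to Fin n using hx
    lift y to Fin n using hyx.trans_lt x.2
    rw [hf] at hxy ⊢
    exact hf y ▸ hcross x y hxy hyx
  · simp only [hf, Fin.val_inj]
    refine ⟨fun h => ?_, fun h => hpart.2 ?_⟩
    · simp only [m, hpart.1 h]
    · rw [← hpart.1 (hm x), h, hpart.1 (hm y)]

end BlockMin

section Tree

/-- The mirror image of a binary tree; it encodes the Kreweras dual, read backwards. -/
def mirror : BinaryTree Unit → BinaryTree Unit
  | nil => nil
  | node _ l r => mirror r △ mirror l

@[simp] theorem numNodes_mirror (t : BinaryTree Unit) : (mirror t).numNodes = t.numNodes := by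
  induction t with
  | nil => rfl
  | node _ l r hl hr => simp [mirror, hl, hr, add_comm]

@[simp] theorem mirror_mirror (t : BinaryTree Unit) : mirror (mirror t) = t := by
  induction t with
  | nil => rfl
  | node _ l r hl hr => simp [mirror, hl, hr]

/-- The block-minimum function of the noncrossing partition of `{0, …, n - 1}` encoded by a binary
tree with `n` nodes: at a node whose left subtree has `i` nodes, the subtrees encode partitions of
`{0, …, i - 1}` and `{i + 1, …, n - 1}`, and `i` is added to the block of `0`. -/
def low : BinaryTree Unit → ℕ → ℕ
  | nil, _ => 0
  | node _ l r, x =>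
    if x < l.numNodes then low l x
    else if x = l.numNodes then 0
    else l.numNodes + 1 + low r (x - (l.numNodes + 1))

/-- Labels for the blocks of the Kreweras dual of the partition encoded by `t`. -/
def colow (t : BinaryTree Unit) (x : ℕ) : ℕ := low (mirror t) (t.numNodes - 1 - x)

variable {l r t : BinaryTree Unit} {x y n : ℕ}

theorem low_node_left (hx : x < l.numNodes) : low (l △ r) x = low l x := by
  simp [low, hx]

theorem low_node_mid : low (l △ r) l.numNodes = 0 := by
  simp [low]

theorem low_node_right : low (l △ r) (l.numNodes + 1 + x) = l.numNodes + 1 + low r x := by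
  have hlt : ¬ l.numNodes + 1 + x < l.numNodes := by omega
  have hne : ¬ l.numNodes + 1 + x = l.numNodes := by omega
  simp [low, hlt, hne]

theorem colow_node_left (hx : x < l.numNodes) :
    colow (l △ r) x = r.numNodes + 1 + colow l x := by
  have hrev : l.numNodes + r.numNodes + 1 - 1 - x
      = (mirror r).numNodes + 1 + (l.numNodes - 1 - x) := by
    rw [numNodes_mirror]
    omega
  simp only [colow, mirror, numNodes]
  rw [hrev, low_node_right, numNodes_mirror]

theorem colow_node_mid : colow (l △ r) l.numNodes = 0 := by
  have hrev : l.numNodes + r.numNodes + 1 - 1 - l.numNodes = (mirror r).numNodes := by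
    rw [numNodes_mirror]
    omega
  simp only [colow, mirror, numNodes]
  rw [hrev, low_node_mid]

theorem colow_node_right (hx : x < r.numNodes) :
    colow (l △ r) (l.numNodes + 1 + x) = colow r x := by
  have hrev : l.numNodes + r.numNodes + 1 - 1 - (l.numNodes + 1 + x) = r.numNodes - 1 - x := by
    omega
  simp only [colow, mirror, numNodes]
  rw [hrev, low_node_left]
  rw [numNodes_mirror]
  omega

theorem forall_lt_numNodes_node {p : ℕ → Prop} :
    (∀ x < (l △ r).numNodes, p x) ↔
      (∀ x < l.numNodes, p x) ∧ p l.numNodes ∧ ∀ x < r.numNodes, p (l.numNodes + 1 + x) := by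
  simp only [numNodes]
  refine ⟨fun H => ⟨fun x hx => H x (by omega), H _ (by omega), fun x hx => H _ (by omega)⟩,
    fun ⟨hleft, hmid, hright⟩ x hx => ?_⟩
  rcases lt_trichotomy x l.numNodes with h | rfl | h
  · exact hleft x h
  · exact hmid
  · have hxr := hright (x - (l.numNodes + 1)) (by omega)
    rwa [Nat.add_sub_cancel' h] at hxr

theorem low_le : ∀ x < t.numNodes, low t x ≤ x := by
  induction t using unitRecOn with
  | base => simp
  | ind l r hl hr =>
    refine forall_lt_numNodes_node.2 ⟨fun x hx => ?_, ?_, fun x hx => ?_⟩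
    · rw [low_node_left hx]
      exact hl x hx
    · rw [low_node_mid]
      exact Nat.zero_le _
    · rw [low_node_right]
      exact Nat.add_le_add_left (hr x hx) _

theorem low_zero : low t 0 = 0 := by
  cases t with
  | nil => rfl
  | node => exact Nat.le_zero.1 (low_le 0 (by simp))

theorem colow_lt (hx : x < t.numNodes) : colow t x < t.numNodes := by
  have hlow := low_le (t := mirror t) (t.numNodes - 1 - x) (by rw [numNodes_mirror]; omega)
  rw [colow]
  omega

theorem colow_last : colow t (t.numNodes - 1) = 0 := by
  rw [colow, Nat.sub_self, low_zero]

theorem isBlockMin_low : IsBlockMin t.numNodes (low t) := by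
  refine ⟨low_le, ?_⟩
  induction t using unitRecOn with
  | base => simp
  | ind l r hl hr =>
    refine forall_lt_numNodes_node.2 ⟨fun x hx y hxy hyx => ?_, fun y _ _ => ?_,
      fun x hx y hxy hyx => ?_⟩
    · rw [low_node_left hx] at hxy ⊢
      rw [low_node_left (hyx.trans_lt hx)]
      exact hl x hx y hxy hyx
    · rw [low_node_mid]
      exact Nat.zero_le _
    · rw [low_node_right] at hxy ⊢
      obtain ⟨z, rfl⟩ := Nat.exists_eq_add_of_le ((Nat.le_add_right _ _).trans hxy)
      rw [low_node_right]
      exact Nat.add_le_add_left (hr x hx z (by omega) (by omega)) _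

theorem IsBlockMin.exists_low_eq {f : ℕ → ℕ} (hf : IsBlockMin n f) :
    ∃ t : BinaryTree Unit, t.numNodes = n ∧ ∀ x < n, low t x = f x := by
  induction n using Nat.strong_induction_on generalizing f with
  | _ n ih =>
    rcases Nat.eq_zero_or_pos n with rfl | hn
    · exact ⟨nil, rfl, by simp⟩
    -- `i` is the last element of the block of `0`.
    obtain ⟨i, hin, hi, hlast⟩ : ∃ i < n, f i = 0 ∧ ∀ x < n, i < x → f x ≠ 0 := by
      have hf0 : f 0 = 0 := Nat.le_zero.1 (hf.le 0 hn)
      have hspec := Nat.findGreatest_spec (P := fun x => f x = 0) (Nat.zero_le (n - 1)) hf0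
      exact ⟨_, (Nat.findGreatest_le (n - 1)).trans_lt (by omega), hspec,
        fun x hx hix => Nat.findGreatest_is_greatest (P := fun x => f x = 0) hix (by omega)⟩
    have hgt (x : ℕ) (hx : x < n) (hix : i < x) : i < f x := by
      by_contra! hle
      have hfi := hf.le_of_mem x hx i hle hix.le
      exact hlast x hx hix (by omega)
    obtain ⟨l, hl, hlf⟩ := ih i hin
      ⟨fun x hx => hf.le x (by omega), fun x hx => hf.le_of_mem x (by omega)⟩
    obtain ⟨r, hr, hrf⟩ := ih (n - (i + 1)) (by omega) (f := fun x => f (i + 1 + x) - (i + 1))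
      ⟨fun x hx => by have := hf.le (i + 1 + x) (by omega); omega,
        fun x hx y hxy hyx => by
          have := hf.le_of_mem (i + 1 + x) (by omega) (i + 1 + y) (by omega) (by omega)
          omega⟩
    have hnum : (l △ r).numNodes = n := by
      simp only [numNodes]
      omega
    refine ⟨l △ r, hnum, hnum ▸ forall_lt_numNodes_node.2 ⟨fun x hx => ?_, ?_, fun x hx => ?_⟩⟩
    · rw [low_node_left hx, hlf x (by omega)]
    · rw [low_node_mid, hl, hi]
    · rw [low_node_right, hrf x (by omega), hl]
      have := hgt (i + 1 + x) (by omega) (by omega)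
      omega

theorem eq_of_low_eq {t' : BinaryTree Unit} (hnum : t.numNodes = t'.numNodes)
    (hlow : ∀ x < t.numNodes, low t x = low t' x) : t = t' := by
  induction t using unitRecOn generalizing t' with
  | base =>
    cases t' with
    | nil => rfl
    | node => simp at hnum
  | ind l r hl hr =>
    cases t' with
    | nil => simp at hnum
    | node _ l' r' =>
      have hlast {l r : BinaryTree Unit} {x : ℕ} (h : low (l △ r) x = 0) : x ≤ l.numNodes := by
        by_contra! hlt
        obtain ⟨y, rfl⟩ := Nat.exists_eq_add_of_le hlt
        rw [Nat.succ_eq_add_one, low_node_right] at h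
        omega
      have hroot : l.numNodes = l'.numNodes := by
        refine le_antisymm (hlast (r := r') ?_) (hlast (r := r) ?_)
        · exact (hlow _ (by simp)).symm.trans low_node_mid
        · exact (hlow _ (by rw [hnum]; simp)).trans low_node_mid
      obtain ⟨hleft, -, hright⟩ := forall_lt_numNodes_node.1 hlow
      congr 1
      · refine hl hroot fun x hx => ?_
        rw [← low_node_left (r := r) hx, hleft x hx]
        exact low_node_left (hroot ▸ hx)
      · refine hr (by simp only [numNodes] at hnum; omega) fun x hx => ?_
        have hlow_x := hright x hx
        rw [low_node_right, hroot, low_node_right] at hlow_x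
        omega

theorem colow_node_le (hl : l.numNodes ≤ x) (hx : x < (l △ r).numNodes) :
    colow (l △ r) x ≤ r.numNodes := by
  rcases hl.eq_or_lt with rfl | hl
  · rw [colow_node_mid]
    exact Nat.zero_le _
  · obtain ⟨x, rfl⟩ := Nat.exists_eq_add_of_lt hl
    rw [add_right_comm] at hx ⊢
    have hxr : x < r.numNodes := by
      simp only [numNodes] at hx
      omega
    rw [colow_node_right hxr]
    exact (colow_lt hxr).le

theorem colow_eq_iff {a b : ℕ} (hab : a ≤ b) (hb : b < t.numNodes) :
    colow t a = colow t b ↔ ∀ x < t.numNodes, (x ∈ Ioc a b ↔ low t x ∈ Ioc a b) := by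
  simp only [mem_Ioc]
  induction t using unitRecOn generalizing a b with
  | base => simp at hb
  | ind l r hl hr =>
    rcases hab.eq_or_lt with rfl | hab
    · exact iff_of_true rfl fun x _ => by omega
    rw [forall_lt_numNodes_node, low_node_mid]
    simp only [low_node_right]
    rcases lt_or_ge b l.numNodes with hbl | hlb
    · have hal := hab.trans hbl
      rw [colow_node_left hal, colow_node_left hbl, add_right_inj, hl hab.le hbl,
        and_iff_left ⟨by omega, by omega⟩]
      exact forall₂_congr fun x hx => by rw [low_node_left hx]
    rcases lt_or_ge a l.numNodes with hal | hla
    · have hcolow := colow_node_le hlb hb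
      rw [colow_node_left hal]
      exact iff_of_false (by omega) fun ⟨_, hmid, _⟩ => by omega
    obtain ⟨b, rfl⟩ := Nat.exists_eq_add_of_lt (hla.trans_lt hab)
    rw [add_right_comm] at hab hb ⊢
    have hbr : b < r.numNodes := by
      simp only [numNodes] at hb
      omega
    rw [colow_node_right hbr, and_iff_right fun x hx => ?_, and_iff_right (by omega)]
    swap
    · rw [low_node_left hx]
      have := low_le x hx
      omega
    rcases hla.eq_or_lt with rfl | hla
    · rw [colow_node_mid, ← colow_last (t := r), eq_comm, hr (by omega) (by omega)]
      refine forall₂_congr fun x hx => ?_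
      have := low_le x hx
      omega
    · obtain ⟨a, rfl⟩ := Nat.exists_eq_add_of_lt hla
      rw [add_right_comm] at hab ⊢
      rw [colow_node_right (by omega), hr (by omega) hbr]
      exact forall₂_congr fun x _ => by omega

end Tree

section TreePartition

/-- The noncrossing partition of `Fin n` encoded by a binary tree with `n` nodes. -/
def treePartition (n : ℕ) (t : BinaryTree Unit) : Finpartition (univ : Finset (Fin n)) :=
  fiberPartition fun x => low t x

variable {n : ℕ} {t : BinaryTree Unit}

theorem isNoncrossing_treePartition (ht : t.numNodes = n) :
    IsNoncrossing (treePartition n t) :=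
  (ht ▸ isBlockMin_low : IsBlockMin n (low t)).isNoncrossing

theorem treePartition_injOn :
    Set.InjOn (treePartition n) (treesOfNumNodesEq n : Set (BinaryTree Unit)) := by
  intro t ht t' ht' h
  obtain rfl : t.numNodes = n := mem_treesOfNumNodesEq.1 ht
  have ht' : t'.numNodes = t.numNodes := mem_treesOfNumNodesEq.1 ht'
  exact eq_of_low_eq ht'.symm
    (isBlockMin_low.eq_of_fiberPartition_eq (ht' ▸ isBlockMin_low) h)

theorem IsNoncrossing.exists_treePartition_eq {π : Finpartition (univ : Finset (Fin n))}
    (hπ : IsNoncrossing π) : ∃ t : BinaryTree Unit, t.numNodes = n ∧ treePartition n t = π := by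
  obtain ⟨f, hf, rfl⟩ := hπ.exists_isBlockMin
  obtain ⟨t, ht, htf⟩ := hf.exists_low_eq
  refine ⟨t, ht, congrArg fiberPartition ?_⟩
  exact funext fun x => htf x x.2

theorem sum_isNoncrossing {M : Type*} [AddCommMonoid M]
    (F : Finpartition (univ : Finset (Fin n)) → M) :
    ∑ π with IsNoncrossing π, F π = ∑ t ∈ treesOfNumNodesEq n, F (treePartition n t) := by
  refine (sum_nbij (treePartition n) (fun t ht => ?_) treePartition_injOn (fun π hπ => ?_)
    fun _ _ => rfl).symm
  · exact mem_filter.2 ⟨mem_univ _, isNoncrossing_treePartition (mem_treesOfNumNodesEq.1 ht)⟩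
  · obtain ⟨t, ht, rfl⟩ := IsNoncrossing.exists_treePartition_eq (mem_filter.1 hπ).2
    exact ⟨t, mem_treesOfNumNodesEq.2 ht, rfl⟩

theorem dual_treePartition (ht : t.numNodes = n) :
    dual (treePartition n t) = fiberPartition fun x : Fin n => colow t x := by
  subst ht
  have hregion {i j : Fin t.numNodes} (hij : i ≤ j) :
      SameRegion (treePartition t.numNodes t) i j ↔ colow t i = colow t j := by
    rw [treePartition, isBlockMin_low.sameRegion_iff hij, colow_eq_iff hij j.2]
  refine eq_fiberPartition fun i j => Finpartition.mem_part_ofSetoid_iff_rel.trans ?_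
  rcases le_total i j with hij | hji
  · exact hregion hij
  · rw [eq_comm, ← hregion hji]
    exact ⟨(regionSetoid _).symm, (regionSetoid _).symm⟩

end TreePartition

section BlockWeight

/-- The number of nodes on the left spine of a tree, which is the size of the block of `0` in the
partition encoded by the tree. -/
def spine : BinaryTree Unit → ℕ
  | nil => 0
  | node _ l _ => spine l + 1

/-- The size of the dual block of `0'` in the partition encoded by a tree. -/
def cospine : BinaryTree Unit → ℕ
  | nil => 0
  | node _ nil r => spine (mirror r) + 1
  | node _ (node u l r) _ => cospine (node u l r)

/-- The number of elements of the block with least element `v` in the partition encoded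
by `t`. -/
def blockSize (t : BinaryTree Unit) (v : ℕ) : ℕ := #{x ∈ range t.numNodes | low t x = v}

section CommMonoid

variable {M : Type*} [CommMonoid M] (α : ℕ → M)

/-- The product of the weights of the blocks not containing `0` in the partition encoded by a
tree, where a block of `m` elements has weight `α m`. -/
def openWt : BinaryTree Unit → M
  | nil => 1
  | node _ l r => openWt l * (α (spine r) * openWt r)

/-- The product of the weights of all the blocks in the partition encoded by a tree, where a block
of `m` elements has weight `α m`. -/
def blockWt (t : BinaryTree Unit) : M := α (spine t) * openWt α t

end CommMonoid

variable {n : ℕ} {l r t : BinaryTree Unit}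

@[simp] theorem spine_eq_zero : spine t = 0 ↔ t = nil := by
  cases t <;> simp [spine]

@[simp] theorem mirror_eq_nil : mirror t = nil ↔ t = nil := by
  cases t <;> simp [mirror]

theorem blockSize_node (v : ℕ) :
    blockSize (l △ r) v = blockSize l v + (if v = 0 then 1 else 0) +
      (if l.numNodes < v then blockSize r (v - (l.numNodes + 1)) else 0) := by
  simp only [blockSize, card_filter, numNodes]
  rw [add_right_comm, sum_range_add, sum_range_succ, low_node_mid]
  congr 2
  · exact sum_congr rfl fun x hx => by rw [low_node_left (mem_range.1 hx)]
  · exact if_congr eq_comm rfl rfl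
  · split_ifs with hv
    · refine sum_congr rfl fun x _ => ?_
      rw [low_node_right]
      exact if_congr (by omega) rfl rfl
    · refine sum_eq_zero fun x _ => ?_
      rw [low_node_right, if_neg (by omega)]

theorem blockSize_of_le {v : ℕ} (hv : t.numNodes ≤ v) : blockSize t v = 0 := by
  rw [blockSize, card_eq_zero, filter_eq_empty_iff]
  intro x hx
  have hxt := mem_range.1 hx
  have := low_le x hxt
  omega

theorem blockSize_zero : blockSize t 0 = spine t := by
  induction t using unitRecOn with
  | base => rfl
  | ind l r hl _ => simp [blockSize_node, hl, spine]

theorem blockSize_colow_zero : blockSize (mirror t) (colow t 0) = cospine t := by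
  induction t with
  | nil => rfl
  | node _ l r hl _ =>
    cases l with
    | nil => rw [show colow (nil △ r) 0 = 0 from colow_node_mid, blockSize_zero]; rfl
    | node u l l' =>
      rw [colow_node_left (by simp), mirror, blockSize_node, numNodes_mirror,
        blockSize_of_le (by rw [numNodes_mirror]; omega), if_neg (by omega), if_pos (by omega),
        Nat.add_sub_cancel_left, zero_add, zero_add, hl, cospine]

theorem card_fiber_low (ht : t.numNodes = n) (v : ℕ) :
    #{x : Fin n | low t x = v} = blockSize t v := by
  rw [blockSize, ht, card_filter, card_filter, sum_range]

theorem card_fiber_colow (ht : t.numNodes = n) (v : ℕ) :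
    #{x : Fin n | colow t x = v} = blockSize (mirror t) v := by
  rw [← card_fiber_low (n := n) ((numNodes_mirror t).trans ht)]
  refine card_equiv Fin.revPerm fun x => ?_
  have hrev : n - 1 - (x : ℕ) = n - (x + 1) := by omega
  simp only [mem_filter, mem_univ, true_and, colow, Fin.revPerm_apply, Fin.val_rev, ht, hrev]

theorem singleton_zero_mem_parts_treePartition (ht : t.numNodes = n + 1) :
    {0} ∈ (treePartition (n + 1) t).parts ↔ spine t = 1 := by
  rw [treePartition, singleton_mem_parts_fiberPartition, card_fiber_low ht, Fin.val_zero,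
    low_zero, blockSize_zero]

theorem singleton_zero_mem_parts_dual_treePartition (ht : t.numNodes = n + 1) :
    {0} ∈ (dual (treePartition (n + 1) t)).parts ↔ cospine t = 1 := by
  rw [dual_treePartition ht, singleton_mem_parts_fiberPartition, card_fiber_colow ht,
    Fin.val_zero, blockSize_colow_zero]

section CommMonoid

variable {M : Type*} [CommMonoid M] {α : ℕ → M}

theorem prod_blockSize_succ :
    ∏ v ∈ range t.numNodes, α (blockSize t (v + 1)) = openWt α t := by
  induction t using unitRecOn with
  | base => simp [openWt]
  | ind l r hl hr =>
    rw [numNodes, openWt, add_assoc, prod_range_add, ← hl, ← hr, ← blockSize_zero,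
      mul_comm (α _), ← prod_range_succ' fun v => α (blockSize r v)]
    refine congrArg₂ _ (prod_congr rfl fun v hv => ?_) (prod_congr rfl fun v _ => ?_)
    · have := mem_range.1 hv
      rw [blockSize_node, if_neg (by omega), if_neg (by omega), add_zero, add_zero]
    · rw [blockSize_node, blockSize_of_le (by omega), if_neg (by omega), if_pos (by omega),
        zero_add, zero_add]
      congr 2
      omega

theorem prod_blockSize (hα : α 0 = 1) :
    ∏ v ∈ range t.numNodes, α (blockSize t v) = blockWt α t := by
  rw [blockWt, ← prod_blockSize_succ, ← blockSize_zero, mul_comm,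
    ← prod_range_succ' fun v => α (blockSize t v), prod_range_succ, blockSize_of_le le_rfl, hα,
    mul_one]

theorem prod_parts_treePartition (hα : α 0 = 1) (ht : t.numNodes = n) :
    ∏ B ∈ (treePartition n t).parts, α #B = blockWt α t := by
  subst ht
  have hlow (x : Fin t.numNodes) : low t x ∈ range t.numNodes :=
    mem_range.2 ((low_le x x.2).trans_lt x.2)
  rw [treePartition, prod_parts_fiberPartition hα hlow, ← prod_blockSize hα]
  simp only [card_fiber_low rfl]

theorem prod_parts_dual_treePartition (hα : α 0 = 1) (ht : t.numNodes = n) :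
    ∏ B ∈ (dual (treePartition n t)).parts, α #B = blockWt α (mirror t) := by
  subst ht
  have hcolow (x : Fin t.numNodes) : colow t x ∈ range t.numNodes := mem_range.2 (colow_lt x.2)
  rw [dual_treePartition rfl, prod_parts_fiberPartition hα hcolow, ← prod_blockSize hα,
    numNodes_mirror]
  simp only [card_fiber_colow rfl]

theorem blockWt_mul_openWt_mirror (u : M) :
    blockWt (fun m => if m = 0 then 1 else u) t * openWt (fun m => if m = 0 then 1 else u)
      (mirror t) = u ^ t.numNodes := by
  induction t using unitRecOn with
  | base => simp [blockWt, openWt, spine, mirror]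
  | ind l r hl hr =>
    simp only [blockWt, openWt, spine, mirror, numNodes, spine_eq_zero, mirror_eq_nil,
      Nat.add_eq_zero_iff, one_ne_zero, and_false, if_false, pow_succ, pow_add] at hl hr ⊢
    rw [← hl, ← hr]
    ac_rfl

end CommMonoid

theorem IsNoncrossing.card_parts_add_card_parts_dual
    {π : Finpartition (univ : Finset (Fin (n + 1)))} (hπ : IsNoncrossing π) :
    #π.parts + #(dual π).parts = n + 2 := by
  obtain ⟨t, ht, rfl⟩ := hπ.exists_treePartition_eq
  -- With weight `2` for each block, the product of the weights is `2` to the number of blocks.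
  let α (m : ℕ) : ℕ := if m = 0 then 1 else 2
  have hprod (π : Finpartition (univ : Finset (Fin (n + 1)))) :
      ∏ B ∈ π.parts, α #B = 2 ^ #π.parts :=
    prod_eq_pow_card fun B hB => if_neg (card_pos.2 (π.nonempty_of_mem_parts hB)).ne'
  have hspine : α (spine (mirror t)) = 2 := if_neg <| by
    rw [spine_eq_zero, mirror_eq_nil]
    rintro rfl
    simp at ht
  refine Nat.pow_right_injective le_rfl (?_ : 2 ^ _ = 2 ^ _)
  rw [pow_add, ← hprod, ← hprod, prod_parts_treePartition rfl ht,
    prod_parts_dual_treePartition rfl ht, blockWt, blockWt, hspine, mul_left_comm, ← blockWt,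
    blockWt_mul_openWt_mirror, ht, ← pow_succ']

end BlockWeight

section PowerSeries

open PowerSeries

variable {R : Type*} [CommRing R]

theorem powerSeries_eq_of_X_pow_dvd_sub {f g : R⟦X⟧} (h : ∀ n, X ^ n ∣ f - g) : f = g := by
  ext n
  have hn := X_pow_dvd_iff.1 (h (n + 1)) n n.lt_succ_self
  rwa [map_sub, sub_eq_zero] at hn

theorem hasSubst_X_mul (h : R⟦X⟧) : HasSubst (X * h) :=
  HasSubst.of_constantCoeff_zero' (by simp)

theorem X_pow_dvd_subst_sub_subst (f : R⟦X⟧) {u v : R⟦X⟧} (hu : HasSubst u) (hv : HasSubst v)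
    {n : ℕ} (h : X ^ n ∣ u - v) : X ^ n ∣ f.subst u - f.subst v := by
  refine X_pow_dvd_iff.2 fun m hm => ?_
  rw [map_sub, coeff_subst' hu, coeff_subst' hv, sub_eq_zero]
  refine finsum_congr fun k => ?_
  have hk := X_pow_dvd_iff.1 (h.trans (sub_dvd_pow_sub_pow u v k)) m hm
  rw [map_sub, sub_eq_zero] at hk
  rw [hk]

theorem X_pow_succ_dvd_subst_sub_subst (P : R⟦X⟧) {G G' : R⟦X⟧} (s : R) (d : ℕ) {n : ℕ}
    (h : X ^ n ∣ G - G') :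
    X ^ (n + 1) ∣ P.subst (X * C s * G ^ d) - P.subst (X * C s * G' ^ d) := by
  simp only [mul_assoc]
  refine X_pow_dvd_subst_sub_subst P (hasSubst_X_mul _) (hasSubst_X_mul _) ?_
  rw [← mul_sub, ← mul_sub, pow_succ']
  exact mul_dvd_mul_left X ((h.trans (sub_dvd_pow_sub_pow G G' d)).mul_left _)

theorem eq_of_subst_system {P Q F G F' G' : R⟦X⟧} {s t : R} {d : ℕ}
    (hF : F = P.subst (X * C s * G ^ d)) (hG : G = Q.subst (X * C t * F ^ d))
    (hF' : F' = P.subst (X * C s * G' ^ d)) (hG' : G' = Q.subst (X * C t * F' ^ d)) :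
    F = F' ∧ G = G' := by
  have hdvd (n : ℕ) : X ^ n ∣ F - F' ∧ X ^ n ∣ G - G' := by
    induction n with
    | zero => simp
    | succ n ih =>
      constructor
      · rw [hF, hF']
        exact X_pow_succ_dvd_subst_sub_subst P s d ih.2
      · rw [hG, hG']
        exact X_pow_succ_dvd_subst_sub_subst Q t d ih.1
  exact ⟨powerSeries_eq_of_X_pow_dvd_sub fun n => (hdvd n).1,
    powerSeries_eq_of_X_pow_dvd_sub fun n => (hdvd n).2⟩

theorem subst_X_mul_mk (φ : ℕ → R) (h : R⟦X⟧) :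
    (mk φ).subst (X * h) = C (φ 0) + X * (mk fun k => φ (k + 1)).subst (X * h) * h := by
  have hφ : mk φ = C (φ 0) + X * PowerSeries.mk fun k => φ (k + 1) := by
    ext n
    cases n <;> simp [coeff_succ_X_mul]
  have hC : (C (φ 0) : R⟦X⟧).subst (X * h) = C (φ 0) := subst_C _
  rw [hφ, subst_add (hasSubst_X_mul h), subst_mul (hasSubst_X_mul h),
    subst_X (hasSubst_X_mul h), hC, mul_right_comm]

theorem eq_mk_subst_of_shift_recursion {D : (ℕ → R) → R⟦X⟧} {h : R⟦X⟧}
    (hD : ∀ φ, D φ = C (φ 0) + X * D (fun k => φ (k + 1)) * h) (φ : ℕ → R) :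
    D φ = (mk φ).subst (X * h) := by
  refine powerSeries_eq_of_X_pow_dvd_sub fun n => ?_
  induction n generalizing φ with
  | zero => simp
  | succ n ih =>
    obtain ⟨q, hq⟩ := ih fun k => φ (k + 1)
    refine ⟨q * h, ?_⟩
    rw [hD φ, subst_X_mul_mk, pow_succ]
    linear_combination X * h * hq

theorem expand_injective {d : ℕ} (hd : d ≠ 0) : Function.Injective (expand (R := R) d hd) := by
  intro f g h
  ext n
  rw [← coeff_expand_mul d hd f, h, coeff_expand_mul]

theorem expand_rescale_subst {d : ℕ} (hd : d ≠ 0) (s : R) (f H : R⟦X⟧) :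
    (expand d hd (rescale s f)).subst (X * expand d hd H)
      = expand d hd (f.subst (X * C s * H ^ d)) := by
  have hX := hasSubst_X_mul (expand d hd H)
  have hXd : HasSubst (X * C s * H ^ d) := mul_assoc (X : R⟦X⟧) _ _ ▸ hasSubst_X_mul _
  have hsX : HasSubst (s • X : R⟦X⟧) := HasSubst.smul_X' s
  have hpow : HasSubst (X ^ d * expand d hd H ^ d) :=
    HasSubst.of_constantCoeff_zero' (by simp [hd])
  calc (expand d hd (rescale s f)).subst (X * expand d hd H)
      = f.subst (s • (X ^ d * expand d hd H ^ d)) := by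
        rw [rescale_eq_subst, expand_apply d hd (subst _ f),
          subst_comp_subst_apply (HasSubst.X_pow hd) hX, subst_pow hX, subst_X hX, mul_pow,
          subst_comp_subst_apply hsX hpow, subst_smul hpow, subst_X hpow]
    _ = f.subst (expand d hd (X * C s * H ^ d)) := by
        rw [map_mul, map_mul, expand_X, expand_C, map_pow, smul_eq_C_mul, mul_left_comm, mul_assoc]
    _ = expand d hd (f.subst (X * C s * H ^ d)) := (expand_subst d hd hXd f).symm

end PowerSeries

section TreeSeries

open PowerSeries

theorem sum_treesOfNumNodesEq_succ {M : Type*} [AddCommMonoid M] (w : BinaryTree Unit → M)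
    (n : ℕ) :
    ∑ t ∈ treesOfNumNodesEq (n + 1), w t = ∑ ij ∈ antidiagonal n,
      ∑ l ∈ treesOfNumNodesEq ij.1, ∑ r ∈ treesOfNumNodesEq ij.2, w (l △ r) := by
  rw [treesOfNumNodesEq_succ, sum_biUnion]
  · refine sum_congr rfl fun ij _ => ?_
    rw [pairwiseNode, sum_map, sum_product]
    rfl
  · intro i _ j _ hij
    refine disjoint_left.2 fun t ht ht' => ?_
    obtain ⟨p, hp, rfl⟩ := mem_map.1 ht
    obtain ⟨q, hq, h⟩ := mem_map.1 ht'
    obtain rfl : q = p := Function.Embedding.injective _ h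
    simp only [mem_product, mem_treesOfNumNodesEq] at hp hq
    exact hij (Prod.ext (hp.1.symm.trans hq.1) (hp.2.symm.trans hq.2))

theorem sum_treesOfNumNodesEq_comp_mirror {M : Type*} [AddCommMonoid M]
    (w : BinaryTree Unit → M) (n : ℕ) :
    ∑ t ∈ treesOfNumNodesEq n, w (mirror t) = ∑ t ∈ treesOfNumNodesEq n, w t :=
  sum_nbij' mirror mirror (by simp) (by simp) (by simp) (by simp) (by simp)

/-- The tree obtained by adding a leaf at the bottom of the left spine: in the encoded partition, a
new least element joins the block of the old one. -/
def growSpine : BinaryTree Unit → BinaryTree Unit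
  | nil => nil △ nil
  | node _ l r => growSpine l △ r

theorem numNodes_growSpine (t : BinaryTree Unit) :
    (growSpine t).numNodes = t.numNodes + 1 := by
  induction t with
  | nil => rfl
  | node _ l r hl _ =>
    simp only [growSpine, numNodes, hl]
    omega

theorem growSpine_ne_nil (t : BinaryTree Unit) : growSpine t ≠ nil := by
  cases t <;> simp [growSpine]

theorem growSpine_injective : Function.Injective growSpine := by
  intro t t' h
  induction t generalizing t' with
  | nil =>
    cases t' with
    | nil => rfl
    | node _ l' _ => exact absurd (node.inj h).2.1.symm (growSpine_ne_nil l')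
  | node _ l r hl _ =>
    cases t' with
    | nil => exact absurd (node.inj h).2.1 (growSpine_ne_nil l)
    | node _ l' r' =>
      obtain ⟨-, hll', rfl⟩ := node.inj h
      rw [hl hll']

theorem cospine_growSpine (t : BinaryTree Unit) : cospine (growSpine t) = 1 := by
  induction t with
  | nil => rfl
  | node _ l r hl _ =>
    rw [growSpine]
    cases h : growSpine l with
    | nil => exact absurd h (growSpine_ne_nil l)
    | node => rwa [cospine, ← h]

theorem exists_growSpine_eq {t : BinaryTree Unit} (ht : cospine t = 1) :
    ∃ t', growSpine t' = t := by
  induction t with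
  | nil => simp [cospine] at ht
  | node _ l r hl _ =>
    cases l with
    | nil =>
      obtain rfl : r = nil := by simpa [cospine] using ht
      exact ⟨nil, rfl⟩
    | node =>
      obtain ⟨t', ht'⟩ := hl ht
      exact ⟨t' △ r, by rw [growSpine, ht']⟩

theorem sum_cospine_eq_one {M : Type*} [AddCommMonoid M] (w : BinaryTree Unit → M) (n : ℕ) :
    ∑ t ∈ treesOfNumNodesEq (n + 1) with cospine t = 1, w t =
      ∑ t ∈ treesOfNumNodesEq n, w (growSpine t) := by
  refine (sum_nbij growSpine (fun t ht => ?_) growSpine_injective.injOn (fun t ht => ?_)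
    fun _ _ => rfl).symm
  · rw [mem_treesOfNumNodesEq] at ht
    rw [mem_filter, mem_treesOfNumNodesEq, numNodes_growSpine, ht]
    exact ⟨rfl, cospine_growSpine t⟩
  · obtain ⟨hn, ht⟩ := mem_filter.1 ht
    obtain ⟨t, rfl⟩ := exists_growSpine_eq ht
    rw [mem_treesOfNumNodesEq, numNodes_growSpine, Nat.add_right_cancel_iff] at hn
    exact ⟨t, mem_treesOfNumNodesEq.2 hn, rfl⟩

variable {R : Type*} [CommRing R]

/-- The generating function of binary trees, by number of nodes, counted with the weight `w`. -/
def treeGF (w : BinaryTree Unit → R) : R⟦X⟧ := mk fun n => ∑ t ∈ treesOfNumNodesEq n, w t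

theorem mk_sum_treesOfNumNodesEq_succ {w w₁ w₂ : BinaryTree Unit → R}
    (h : ∀ l r, w (l △ r) = w₁ l * w₂ r) :
    mk (fun n => ∑ t ∈ treesOfNumNodesEq (n + 1), w t) = treeGF w₁ * treeGF w₂ := by
  ext n
  simp only [treeGF, coeff_mk, coeff_mul, sum_treesOfNumNodesEq_succ, h, sum_mul_sum]

theorem treeGF_eq_C_add_X_mul (w : BinaryTree Unit → R) :
    treeGF w = C (w nil) + X * PowerSeries.mk fun n => ∑ t ∈ treesOfNumNodesEq (n + 1), w t := by
  ext n
  cases n <;> simp [treeGF, treesOfNumNodesEq_zero, coeff_succ_X_mul]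

theorem treeGF_comp_mirror (w : BinaryTree Unit → R) :
    treeGF (fun t => w (mirror t)) = treeGF w :=
  congrArg PowerSeries.mk (funext (sum_treesOfNumNodesEq_comp_mirror w))

end TreeSeries

section MarkedWeight

open PowerSeries

variable {R : Type*} [CommRing R] {α β φ : ℕ → R}

/-- The weight of the partition encoded by a tree, where a block of `m` elements has weight `φ m` if
it contains `0` and `α m` if not, and a block of `m` elements of the dual partition has
weight `β m`. -/
def markedWt (α β φ : ℕ → R) (t : BinaryTree Unit) : R :=
  φ (spine t) * openWt α t * blockWt β (mirror t)

/-- The generating function of noncrossing partitions, by number of elements, counted with the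
weight `markedWt α β φ`. -/
def markedGF (α β φ : ℕ → R) : R⟦X⟧ := treeGF (markedWt α β φ)

theorem markedWt_self (t : BinaryTree Unit) :
    markedWt α β α t = blockWt α t * blockWt β (mirror t) := rfl

theorem markedWt_nil : markedWt α β φ nil = φ 0 * β 0 := by
  simp [markedWt, blockWt, openWt, spine, mirror]

theorem markedWt_node (l r : BinaryTree Unit) :
    markedWt α β φ (l △ r) =
      markedWt α β (fun k => φ (k + 1)) l * markedWt β α (fun k => β (k + 1)) (mirror r) := by
  simp only [markedWt, blockWt, openWt, spine, mirror, mirror_mirror]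
  ring

theorem markedWt_growSpine (hα : α 0 = 1) (hβ₁ : β 1 = 1) (t : BinaryTree Unit) :
    markedWt α β φ (growSpine t) = markedWt α β (fun k => φ (k + 1)) t := by
  induction t generalizing φ with
  | nil => simp [markedWt, blockWt, openWt, spine, mirror, growSpine, hα, hβ₁]
  | node _ l r hl _ =>
    rw [growSpine, markedWt_node, hl]
    exact (markedWt_node (φ := fun k => φ (k + 1)) l r).symm

theorem mk_sum_markedWt :
    mk (fun n => ∑ t ∈ treesOfNumNodesEq (n + 1), markedWt α β φ t) =
      markedGF α β (fun k => φ (k + 1)) * markedGF β α (fun k => β (k + 1)) := by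
  rw [markedGF, markedGF, ← treeGF_comp_mirror (markedWt β α _)]
  exact mk_sum_treesOfNumNodesEq_succ markedWt_node

theorem markedGF_eq_subst (hβ : β 0 = 1) :
    markedGF α β φ = (mk φ).subst (X * markedGF β α (fun k => β (k + 1))) := by
  refine eq_mk_subst_of_shift_recursion (D := markedGF α β) (fun φ => ?_) φ
  rw [markedGF, treeGF_eq_C_add_X_mul, mk_sum_markedWt, markedWt_nil, hβ, mul_one, mul_assoc]

theorem mk_sum_spine_eq_one (hα₁ : α 1 = 1) (hβ : β 0 = 1) :
    mk (fun n => ∑ t ∈ treesOfNumNodesEq (n + 1) with spine t = 1, markedWt α β α t) =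
      markedGF β α (fun k => β (k + 1)) := by
  have hnode (l r : BinaryTree Unit) :
      (if spine (l △ r) = 1 then markedWt α β α (l △ r) else 0) =
        (if l = nil then 1 else 0) * markedWt β α (fun k => β (k + 1)) (mirror r) := by
    cases l <;> simp [spine, markedWt_node, markedWt_nil, hα₁, hβ]
  have hnil : treeGF (fun t => if t = nil then (1 : R) else 0) = 1 := by
    ext n
    simp [treeGF, coeff_one, sum_ite_eq', mem_treesOfNumNodesEq, eq_comm]
  simp only [sum_filter]
  rw [mk_sum_treesOfNumNodesEq_succ hnode, hnil, one_mul, treeGF_comp_mirror, markedGF]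

theorem mk_sum_cospine_eq_one (hα : α 0 = 1) (hβ₁ : β 1 = 1) :
    mk (fun n => ∑ t ∈ treesOfNumNodesEq (n + 1) with cospine t = 1, markedWt α β φ t) =
      markedGF α β (fun k => φ (k + 1)) := by
  simp only [sum_cospine_eq_one, markedWt_growSpine hα hβ₁]
  rfl

end MarkedWeight

section Indivisible

variable {R : Type*} [CommRing R]

/-- The weight that encodes `d`-indivisibility: a block of `m` elements has weight zero unless `m`
is `1` modulo `d`, and then it has a factor `u` for every `d` elements besides the first. -/
def sizeWt (d : ℕ) (a : ℕ → R) (u : R) : ℕ → R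
  | 0 => 1
  | k + 1 => if d ∣ k then a (k / d) * u ^ (k / d) else 0

variable {n d : ℕ} {a a' : ℕ → R} {s t u : R}

theorem sizeWt_one (ha : a 0 = 1) : sizeWt d a u 1 = 1 := by simp [sizeWt, ha]

theorem mk_sizeWt_succ (hd : d ≠ 0) :
    PowerSeries.mk (fun k => sizeWt d a u (k + 1)) =
      PowerSeries.expand d hd (PowerSeries.rescale u (PowerSeries.mk a)) := by
  ext n
  simp only [sizeWt, PowerSeries.coeff_mk, PowerSeries.coeff_expand, PowerSeries.coeff_rescale,
    mul_comm]

theorem modEq_one_iff_exists_eq_mul_add_one {m : ℕ} (hm : m ≠ 0) :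
    m ≡ 1 [MOD d] ↔ ∃ k, m = d * k + 1 := by
  rw [Nat.ModEq.comm, Nat.modEq_iff_dvd' (Nat.one_le_iff_ne_zero.2 hm)]
  exact exists_congr fun k => by omega

section Parts

variable {π : Finpartition (univ : Finset (Fin n))}

theorem exists_card_eq_mul_add_one (h : ∀ B ∈ π.parts, #B ≡ 1 [MOD d]) {B : Finset (Fin n)}
    (hB : B ∈ π.parts) : ∃ k, #B = d * k + 1 :=
  (modEq_one_iff_exists_eq_mul_add_one (card_pos.2 (π.nonempty_of_mem_parts hB)).ne').1 (h B hB)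

theorem prod_sizeWt_eq_zero (h : ¬ ∀ B ∈ π.parts, #B ≡ 1 [MOD d]) :
    ∏ B ∈ π.parts, sizeWt d a u #B = 0 := by
  push Not at h
  obtain ⟨B, hB, hmod⟩ := h
  refine prod_eq_zero hB ?_
  obtain ⟨m, hm⟩ := Nat.exists_eq_succ_of_ne_zero (card_pos.2 (π.nonempty_of_mem_parts hB)).ne'
  rw [hm, Nat.succ_eq_add_one, modEq_one_iff_exists_eq_mul_add_one m.succ_ne_zero] at hmod
  rw [hm, sizeWt, if_neg]
  rintro ⟨k, rfl⟩
  exact hmod ⟨k, rfl⟩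

theorem mul_sum_card_sub_one_div (h : ∀ B ∈ π.parts, #B ≡ 1 [MOD d]) :
    d * ∑ B ∈ π.parts, (#B - 1) / d + #π.parts = n := by
  have hsum : ∑ B ∈ π.parts, #B = n := by simpa using π.sum_card_parts
  rw [mul_sum, card_eq_sum_ones, ← sum_add_distrib]
  refine (sum_congr rfl fun B hB => ?_).trans hsum
  obtain ⟨k, hk⟩ := exists_card_eq_mul_add_one h hB
  rw [hk, Nat.add_sub_cancel, Nat.mul_div_cancel' (dvd_mul_right d k)]

theorem prod_sizeWt (hd : d ≠ 0) (h : ∀ B ∈ π.parts, #B ≡ 1 [MOD d]) :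
    ∏ B ∈ π.parts, sizeWt d a u #B =
      (∏ B ∈ π.parts, a ((#B - 1) / d)) * u ^ ((n - #π.parts) / d) := by
  have hrank : (n - #π.parts) / d = ∑ B ∈ π.parts, (#B - 1) / d :=
    Nat.div_eq_of_eq_mul_right (Nat.pos_of_ne_zero hd)
      (Nat.sub_eq_of_eq_add (mul_sum_card_sub_one_div h).symm)
  rw [hrank, ← prod_pow_eq_pow_sum, ← prod_mul_distrib]
  refine prod_congr rfl fun B hB => ?_
  obtain ⟨k, hk⟩ := exists_card_eq_mul_add_one h hB
  rw [hk, sizeWt, if_pos (dvd_mul_right d k), Nat.add_sub_cancel]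

end Parts

theorem mem_NC {π : Finpartition (univ : Finset (Fin n))} :
    π ∈ NC d n ↔ IsNoncrossing π ∧ (∀ B ∈ π.parts, #B ≡ 1 [MOD d]) ∧
      ∀ B ∈ (dual π).parts, #B ≡ 1 [MOD d] := by
  simp [NC]

section Noncrossing

variable {π : Finpartition (univ : Finset (Fin (n + 1)))}

theorem dvd_of_mem_NC (h : π ∈ NC d (n + 1)) : d ∣ n := by
  obtain ⟨hπ, hparts, hdual⟩ := mem_NC.1 h
  have h₁ := mul_sum_card_sub_one_div hparts
  have h₂ := mul_sum_card_sub_one_div hdual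
  have hcard := hπ.card_parts_add_card_parts_dual
  refine ⟨∑ B ∈ π.parts, (#B - 1) / d + ∑ B ∈ (dual π).parts, (#B - 1) / d, ?_⟩
  rw [mul_add]
  omega

theorem prod_sizeWt_mul_prod_sizeWt_dual (hd : d ≠ 0) (hπ : IsNoncrossing π) :
    (∏ B ∈ π.parts, sizeWt d a t #B) * ∏ B ∈ (dual π).parts, sizeWt d a' s #B =
      if π ∈ NC d (n + 1) then wt d a a' s t π else 0 := by
  have hcard := hπ.card_parts_add_card_parts_dual
  have hrank : n + 1 - #π.parts = #(dual π).parts - 1 := by omega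
  have hcorank : n + 1 - #(dual π).parts = #π.parts - 1 := by omega
  split_ifs with h
  · obtain ⟨-, hparts, hdual⟩ := mem_NC.1 h
    rw [prod_sizeWt hd hparts, prod_sizeWt hd hdual, hrank, hcorank, wt]
    ring
  · rw [mem_NC, not_and, not_and_or] at h
    rcases h hπ with h | h
    · rw [prod_sizeWt_eq_zero h, zero_mul]
    · rw [prod_sizeWt_eq_zero h, mul_zero]

end Noncrossing

theorem sum_NC_wt (hd : d ≠ 0) (p : Finpartition (univ : Finset (Fin (n + 1))) → Prop)
    [DecidablePred p] :
    ∑ π ∈ NC d (n + 1) with p π, wt d a a' s t π =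
      ∑ T ∈ treesOfNumNodesEq (n + 1) with p (treePartition (n + 1) T),
        markedWt (sizeWt d a t) (sizeWt d a' s) (sizeWt d a t) T := by
  have hNC : NC d (n + 1) = {π ∈ univ.filter IsNoncrossing | π ∈ NC d (n + 1)} := by
    ext π
    simp +contextual [mem_NC]
  rw [hNC, filter_comm, sum_filter, sum_filter, sum_isNoncrossing, sum_filter]
  refine sum_congr rfl fun T hT => if_congr Iff.rfl ?_ rfl
  have hT := mem_treesOfNumNodesEq.1 hT
  rw [markedWt_self, ← prod_parts_treePartition rfl hT, ← prod_parts_dual_treePartition rfl hT,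
    prod_sizeWt_mul_prod_sizeWt_dual hd (isNoncrossing_treePartition hT)]

theorem expand_mk_sum_NC_wt (hd : d ≠ 0)
    (p : ∀ n, Finpartition (univ : Finset (Fin (n + 1))) → Prop) [∀ n, DecidablePred (p n)]
    (q : BinaryTree Unit → Prop) [DecidablePred q]
    (hpq : ∀ n T, T.numNodes = n + 1 → (p n (treePartition (n + 1) T) ↔ q T)) :
    PowerSeries.expand d hd
        (PowerSeries.mk fun k => ∑ π ∈ NC d (d * k + 1) with p (d * k) π, wt d a a' s t π) =
      PowerSeries.mk fun n => ∑ T ∈ treesOfNumNodesEq (n + 1) with q T,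
        markedWt (sizeWt d a t) (sizeWt d a' s) (sizeWt d a t) T := by
  ext n
  have hsum : ∑ T ∈ treesOfNumNodesEq (n + 1) with q T,
      markedWt (sizeWt d a t) (sizeWt d a' s) (sizeWt d a t) T =
        ∑ π ∈ NC d (n + 1) with p n π, wt d a a' s t π := by
    rw [sum_NC_wt hd]
    exact sum_congr (filter_congr fun T hT => (hpq n T (mem_treesOfNumNodesEq.1 hT)).symm)
      fun _ _ => rfl
  rw [PowerSeries.coeff_expand, PowerSeries.coeff_mk n, hsum]
  split_ifs with h
  · obtain ⟨k, rfl⟩ := h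
    rw [Nat.mul_div_cancel_left k (Nat.pos_of_ne_zero hd), PowerSeries.coeff_mk]
  · rw [eq_empty_of_forall_notMem fun π hπ => h (dvd_of_mem_NC hπ), filter_empty, sum_empty]

theorem expand_mk_c (hd : d ≠ 0) (ha : a 0 = 1) :
    PowerSeries.expand d hd (PowerSeries.mk (c d a a' s t)) =
      markedGF (sizeWt d a' s) (sizeWt d a t) (fun k => sizeWt d a' s (k + 1)) := by
  rw [← mk_sum_spine_eq_one (sizeWt_one ha) rfl]
  exact expand_mk_sum_NC_wt hd (fun _ π => {0} ∈ π.parts) (fun T => spine T = 1)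
    fun _ _ => singleton_zero_mem_parts_treePartition

theorem expand_mk_cStar (hd : d ≠ 0) (ha' : a' 0 = 1) :
    PowerSeries.expand d hd (PowerSeries.mk (cStar d a a' s t)) =
      markedGF (sizeWt d a t) (sizeWt d a' s) (fun k => sizeWt d a t (k + 1)) := by
  rw [← mk_sum_cospine_eq_one rfl (sizeWt_one ha')]
  exact expand_mk_sum_NC_wt hd (fun _ π => {0} ∈ (dual π).parts) (fun T => cospine T = 1)
    fun _ _ => singleton_zero_mem_parts_dual_treePartition

theorem expand_mk_b (hd : d ≠ 0) :
    PowerSeries.expand d hd (PowerSeries.mk (b d a a' s t)) =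
      markedGF (sizeWt d a t) (sizeWt d a' s) (fun k => sizeWt d a t (k + 1)) *
        markedGF (sizeWt d a' s) (sizeWt d a t) (fun k => sizeWt d a' s (k + 1)) := by
  have h := expand_mk_sum_NC_wt (a := a) (a' := a') (s := s) (t := t) hd (fun _ _ => True)
    (fun _ => True) fun _ _ _ => Iff.rfl
  simp only [filter_true] at h
  rw [← mk_sum_markedWt, ← h]
  rfl

theorem mk_c_eq_subst (hd : d ≠ 0) (ha : a 0 = 1) (ha' : a' 0 = 1) :
    PowerSeries.mk (c d a a' s t) = (PowerSeries.mk a').subst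
      (PowerSeries.X * PowerSeries.C s * PowerSeries.mk (cStar d a a' s t) ^ d) := by
  apply expand_injective hd
  rw [← expand_rescale_subst, ← mk_sizeWt_succ, expand_mk_c hd ha, expand_mk_cStar hd ha']
  exact markedGF_eq_subst rfl

theorem mk_cStar_eq_subst (hd : d ≠ 0) (ha : a 0 = 1) (ha' : a' 0 = 1) :
    PowerSeries.mk (cStar d a a' s t) = (PowerSeries.mk a).subst
      (PowerSeries.X * PowerSeries.C t * PowerSeries.mk (c d a a' s t) ^ d) := by
  apply expand_injective hd
  rw [← expand_rescale_subst, ← mk_sizeWt_succ, expand_mk_c hd ha, expand_mk_cStar hd ha']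
  exact markedGF_eq_subst rfl

theorem mk_b_eq_mul (hd : d ≠ 0) (ha : a 0 = 1) (ha' : a' 0 = 1) :
    PowerSeries.mk (b d a a' s t) =
      PowerSeries.mk (c d a a' s t) * PowerSeries.mk (cStar d a a' s t) := by
  apply expand_injective hd
  rw [map_mul, expand_mk_b hd, expand_mk_c hd ha, expand_mk_cStar hd ha', mul_comm]

end Indivisible

end IndivisibleNC

theorem mainTheorem4 {R : Type*} [CommRing R] (d : ℕ) (hd : 0 < d)
    (a a' : ℕ → R) (ha : a 0 = 1) (ha' : a' 0 = 1) (s t : R)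
    (A A' B C C' : PowerSeries R)
    (hA : A = PowerSeries.mk a) (hA' : A' = PowerSeries.mk a')
    (hB : B = PowerSeries.mk (IndivisibleNC.b d a a' s t))
    (hC : C = PowerSeries.mk (IndivisibleNC.c d a a' s t))
    (hC' : C' = PowerSeries.mk (IndivisibleNC.cStar d a a' s t)) :
    C = A'.subst (PowerSeries.X * PowerSeries.C s * C' ^ d) ∧
    C' = A.subst (PowerSeries.X * PowerSeries.C t * C ^ d) ∧
    B = C * C' ∧
    ∀ F G : PowerSeries R,
      F = A'.subst (PowerSeries.X * PowerSeries.C s * G ^ d) →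
      G = A.subst (PowerSeries.X * PowerSeries.C t * F ^ d) →
      F = C ∧ G = C' := by
  subst hA hA' hB hC hC'
  have hC := IndivisibleNC.mk_c_eq_subst (s := s) (t := t) hd.ne' ha ha'
  have hC' := IndivisibleNC.mk_cStar_eq_subst (s := s) (t := t) hd.ne' ha ha'
  exact ⟨hC, hC', IndivisibleNC.mk_b_eq_mul hd.ne' ha ha',
    fun F G hF hG => IndivisibleNC.eq_of_subst_system hF hG hC hC'⟩
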